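/- Let $2^{\mathbb N}$ be the space of infinite bit sequences and, for a finite string $x$, let $[x]\subseteq 2^{\mathbb N}$ be the set of all infinite extensions of $x$. A probability measure $P$ on $2^{\mathbb N}\times 2^{\mathbb N}$ is called computable if $(x,y)\mapsto P([x]\times[y])$ is a computable real-valued function on pairs of strings; a probability measure $\nu$ on $2^{\mathbb N}$ is called computable relative to $\beta\in 2^{\mathbb N}$ if $x\mapsto \nu([x])$ is a real-valued function computable with oracle $\beta$. Let $P_M(S)=P(2^{\mathbb N}\times S)$ be the marginal measure, and let $$P_C(S|\beta)=\lim_{n\to\infty}\frac{P(S\times[\beta_1\dots\beta_n])}{P(2^{\mathbb N}\times[\beta_1\dots\beta_n])}.$$ Then there exists a computable probability measure $P$ on $2^{\mathbb N}\times 2^{\mathbb N}$ such that the set of all $\beta\in 2^{\mathbb N}$ for which $P_C(\cdot|\beta)$ is defined (all denominators are nonzero and the limit exists for every measurable $S\subseteq 2^{\mathbb N}$), is a probability measure, and is not computable relative to $\beta$, is $P_M$-measurable (measurable for the completion of $P_M$) and has positive $P_M$-measure. -/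

import Mathlib

open MeasureTheory Filter
open scoped Topology

namespace CantorMeasure

/-- Cantor space: infinite bit sequences, with the product topology and product
`σ`-algebra (which is its Borel `σ`-algebra). -/
abbrev Cantor : Type := ℕ → Bool

/-- The basic open set `[x]` of all infinite extensions of the string `x`. -/
def basicOpen (x : List Bool) : Set Cantor :=
  {γ | ∀ (i : ℕ) (h : i < x.length), γ i = x[i]}

/-- The bit sequence `β`, viewed as an oracle. -/
def oracle (β : Cantor) : ℕ →. ℕ := fun n => Part.some (β n).toNat

/-- A real-valued function on a discrete coded domain is computable relative to the oracles in `O`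
if some function, computable relative to `O`, maps `(i, k)` to the numerator `a` of a binary
rational `a / 2 ^ k` that approximates `F i` with error at most `2 ^ (-k)`. -/
def RealComputableIn {ι : Type*} [Primcodable ι] (O : Set (ℕ →. ℕ)) (F : ι → ℝ) : Prop :=
  ∃ a : ι × ℕ → ℤ, ComputableIn O a ∧
    ∀ (i : ι) (k : ℕ), |F i - (a (i, k) : ℝ) / 2 ^ k| ≤ 1 / 2 ^ k

/-- A measure on `2^ℕ` is computable relative to `β` if `x ↦ ν [x]` is. -/
def MeasureComputableRel (β : Cantor) (ν : Measure Cantor) : Prop :=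
  RealComputableIn {oracle β} fun x : List Bool => ν.real (basicOpen x)

/-- A measure on `2^ℕ × 2^ℕ` is computable (without oracle) if `(x, y) ↦ P ([x] × [y])` is. -/
def BivariateComputable (P : Measure (Cantor × Cantor)) : Prop :=
  RealComputableIn ∅ fun p : List Bool × List Bool => P.real (basicOpen p.1 ×ˢ basicOpen p.2)

/-- The marginal `P_M S = P (2^ℕ × S)`. -/
noncomputable def marginal (P : Measure (Cantor × Cantor)) : Measure Cantor :=
  P.map Prod.snd

/-- The conditional measure `P_C(· | β)` is defined and equals the measure `ν`:
for each measurable `S`, the quotient `P (S × [β₁…βₙ]) / P (2^ℕ × [β₁…βₙ])`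
is a genuine quotient (nonzero denominator) and tends to `ν S`.
Here `PiNat.cylinder β n` is the set of sequences with the same first `n` bits as `β`. -/
def IsConditionalMeasure (P : Measure (Cantor × Cantor)) (β : Cantor) (ν : Measure Cantor) :
    Prop :=
  (∀ n : ℕ, P (Set.univ ×ˢ PiNat.cylinder β n) ≠ 0) ∧
    ∀ S : Set Cantor, MeasurableSet S →
      Tendsto
        (fun n : ℕ => P.real (S ×ˢ PiNat.cylinder β n) / P.real (Set.univ ×ˢ PiNat.cylinder β n))
        atTop (𝓝 (ν.real S))

end CantorMeasure

namespace CantorMeasure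

/-! Let `β` be a sequence of fair coin tosses. Given `β`, the first coordinate falls in the `n`-th
pair of isolated points with probability `2 ^ -(n + 1)`, and this mass is split evenly unless
program `n`, run on `n` with finite histories of `β`, eventually outputs `1`. Once this is seen, the
next bit of `β` tilts the split to `3 : 1` or `1 : 3`.

The tilt is fair, so the split is a martingale: the mass of a rectangle depends only on the
densities at a finite stage (`slice_cylinder`), and `joint` is computable although the limiting
densities are not. Each density changes at most once, so the conditional measures converge for every
`β` and every measurable set (`isConditionalMeasure_mixture`).

The limit reveals which programs trigger: the split of pair `n` stays even exactly when program `n`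
never outputs `1`. A `β`-computable conditional measure would decide this, and the decider, given
its own index, contradicts itself (`not_recursiveIn_of_trigger`). Thus every `β` lies in the set. -/

open Nat.Partrec (Code)
open Encodable Denumerable
open scoped ENNReal

/-! ### Oracle computations through finite histories -/

/-- The first `k` bits of `β`, the most recent one first. -/
def history (β : Cantor) : ℕ → List Bool
  | 0 => []
  | k + 1 => β k :: history β k

@[simp]
theorem length_history (β : Cantor) (k : ℕ) : (history β k).length = k := by
  induction k with
  | zero => rfl
  | succ k ih => simp [history, ih]

theorem drop_history (β : Cantor) (i j : ℕ) : (history β (i + j)).drop i = history β j := by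
  induction i with
  | zero => simp
  | succ i ih => rw [Nat.succ_add, history, List.drop_succ_cons, ih]

theorem reverse_history_getElem? (β : Cantor) (k n : ℕ) :
    (history β k).reverse[n]? = if n < k then some (β n) else none := by
  induction k with
  | zero => simp [history]
  | succ k ih =>
    rw [history, List.reverse_cons, List.getElem?_append, ih]
    simp only [List.length_reverse, length_history]
    split_ifs with h1 h2 h2
    · rfl
    · omega
    · have : n = k := by omega
      simp [this]
    · rw [List.getElem?_eq_none]
      simp; omega

theorem history_congr {β γ : Cantor} {k : ℕ} (h : ∀ i < k, β i = γ i) :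
    history β k = history γ k := by
  induction k with
  | zero => rfl
  | succ k ih => simp [history, h k (by simp), ih fun i hi => h i (by omega)]

/-- A function that is recursive in `β` is approximated by a partial recursive function that reads
finite histories of `β`. -/
theorem exists_partrec_history_approx {β : Cantor} {f : ℕ →. ℕ}
    (hf : Nat.RecursiveIn {oracle β} f) :
    ∃ F : List Bool → ℕ →. ℕ, Partrec₂ F ∧ (∀ k n v, v ∈ F (history β k) n → v ∈ f n) ∧
      ∀ n v, v ∈ f n → ∀ᶠ k in atTop, v ∈ F (history β k) n := by
  induction hf with
  | zero =>
    exact ⟨fun _ _ => Part.some 0, (Computable.const 0).partrec, fun _ _ _ h => h,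
      fun _ _ h => Eventually.of_forall fun _ => h⟩
  | succ =>
    exact ⟨fun _ n => Part.some n.succ, (Computable.succ.comp Computable.snd).partrec,
      fun _ _ _ h => h, fun _ _ h => Eventually.of_forall fun _ => h⟩
  | left =>
    exact ⟨fun _ n => Part.some n.unpair.1,
      (Computable.fst.comp (Computable.unpair.comp Computable.snd)).partrec,
      fun _ _ _ h => h, fun _ _ h => Eventually.of_forall fun _ => h⟩
  | right =>
    exact ⟨fun _ n => Part.some n.unpair.2,
      (Computable.snd.comp (Computable.unpair.comp Computable.snd)).partrec,
      fun _ _ _ h => h, fun _ _ h => Eventually.of_forall fun _ => h⟩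
  | oracle g hg =>
    rw [Set.mem_singleton_iff] at hg
    subst hg
    -- The query `n` diverges until the history has more than `n` bits.
    refine ⟨fun σ n => ((σ.reverse[n]?).map Bool.toNat : Option ℕ), ?_, ?_, ?_⟩
    · refine Computable.ofOption (Computable.option_map
        (Computable.list_getElem?.comp (Computable.list_reverse.comp Computable.fst)
          Computable.snd) ?_)
      exact ((Primrec.dom_finite Bool.toNat).to_comp.comp Computable.snd)
    · intro k n v h
      simp only [reverse_history_getElem?] at h
      split_ifs at h
      · simpa [oracle] using h
      · simp at h
    · intro n v h
      filter_upwards [eventually_gt_atTop n] with k hk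
      simp only [reverse_history_getElem?, if_pos hk]
      simpa [oracle] using h
  | @pair f g _ _ ihf ihg =>
    obtain ⟨F, hF, hF1, hF2⟩ := ihf
    obtain ⟨G, hG, hG1, hG2⟩ := ihg
    refine ⟨fun σ n => (F σ n).bind fun a => (G σ n).map fun b => Nat.pair a b, ?_, ?_, ?_⟩
    · refine Partrec.bind hF (Partrec.map (f := fun p : (List Bool × ℕ) × ℕ => G p.1.1 p.1.2)
        (hG.comp (Computable.fst.comp Computable.fst) (Computable.snd.comp Computable.fst)) ?_)
      exact Primrec₂.natPair.to_comp.comp (Computable.snd.comp Computable.fst) Computable.snd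
    · intro k n v h
      simp only [Part.mem_bind_iff, Part.mem_map_iff] at h
      obtain ⟨a, ha, b, hb, rfl⟩ := h
      simp only [Seq.seq, Part.map_eq_map, Part.mem_bind_iff, Part.mem_map_iff]
      exact ⟨_, ⟨a, hF1 _ _ _ ha, rfl⟩, b, hG1 _ _ _ hb, rfl⟩
    · intro n v h
      simp only [Seq.seq, Part.map_eq_map, Part.mem_bind_iff, Part.mem_map_iff] at h
      obtain ⟨_, ⟨a, ha, rfl⟩, b, hb, rfl⟩ := h
      filter_upwards [hF2 _ _ ha, hG2 _ _ hb] with k h1 h2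
      simp only [Part.mem_bind_iff, Part.mem_map_iff]
      exact ⟨a, h1, b, h2, rfl⟩
  | @comp f g _ _ ihf ihg =>
    obtain ⟨F, hF, hF1, hF2⟩ := ihf
    obtain ⟨G, hG, hG1, hG2⟩ := ihg
    refine ⟨fun σ n => (G σ n).bind fun a => F σ a, ?_, ?_, ?_⟩
    · exact Partrec.bind hG (hF.comp (Computable.fst.comp Computable.fst) Computable.snd)
    · intro k n v h
      simp only [Part.mem_bind_iff] at h
      obtain ⟨a, ha, hb⟩ := h
      exact Part.mem_bind_iff.2 ⟨a, hG1 _ _ _ ha, hF1 _ _ _ hb⟩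
    · intro n v h
      obtain ⟨a, ha, hb⟩ := Part.mem_bind_iff.1 h
      filter_upwards [hG2 _ _ ha, hF2 _ _ hb] with k h1 h2
      exact Part.mem_bind_iff.2 ⟨a, h1, h2⟩
  | @prec f g _ _ ihf ihg =>
    obtain ⟨F, hF, hF1, hF2⟩ := ihf
    obtain ⟨G, hG, hG1, hG2⟩ := ihg
    refine ⟨fun σ p => p.unpair.2.rec (F σ p.unpair.1) fun y IH =>
      IH.bind fun i => G σ (Nat.pair p.unpair.1 (Nat.pair y i)), ?_, ?_, ?_⟩
    · have hu : Computable fun q : List Bool × ℕ => q.2.unpair :=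
        Computable.unpair.comp Computable.snd
      refine Partrec.nat_rec (Computable.snd.comp hu)
        (hF.comp Computable.fst (Computable.fst.comp hu)) (h := fun q s =>
          G q.1 (Nat.pair q.2.unpair.1 (Nat.pair s.1 s.2))) ?_
      exact hG.comp (Computable.fst.comp Computable.fst)
        (Primrec₂.natPair.to_comp.comp (Computable.fst.comp (hu.comp Computable.fst))
          (Primrec₂.natPair.to_comp.comp (Computable.fst.comp Computable.snd)
            (Computable.snd.comp Computable.snd)))
    · intro k p
      simp only
      generalize p.unpair.1 = a
      induction p.unpair.2 with
      | zero => exact fun v h => hF1 _ _ _ h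
      | succ m ih =>
        intro v h
        obtain ⟨i, hi, hv⟩ := Part.mem_bind_iff.1 h
        exact Part.mem_bind_iff.2 ⟨i, ih i hi, hG1 _ _ _ hv⟩
    · intro p
      simp only
      generalize p.unpair.1 = a
      induction p.unpair.2 with
      | zero => exact fun v h => hF2 _ _ h
      | succ m ih =>
        intro v h
        obtain ⟨i, hi, hv⟩ := Part.mem_bind_iff.1 h
        filter_upwards [ih i hi, hG2 _ _ hv] with k h1 h2
        exact Part.mem_bind_iff.2 ⟨i, h1, h2⟩
  | @rfind f _ ihf =>
    obtain ⟨F, hF, hF1, hF2⟩ := ihf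
    refine ⟨fun σ a => Nat.rfind fun n => (F σ (Nat.pair a n)).map fun m => decide (m = 0),
      ?_, ?_, ?_⟩
    · refine Partrec.rfind (p := fun (q : List Bool × ℕ) n => (F q.1 (Nat.pair q.2 n)).map fun m => decide (m = 0)) ?_
      refine Partrec.map (hF.comp (Computable.fst.comp Computable.fst)
        (Primrec₂.natPair.to_comp.comp (Computable.snd.comp Computable.fst) Computable.snd)) ?_
      exact (Primrec.eq.decide.comp Primrec.snd (Primrec.const 0)).to_comp
    · intro k a v h
      refine Nat.mem_rfind.2 ?_
      replace h := Nat.mem_rfind.1 h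
      have key : ∀ b n, b ∈ (F (history β k) (Nat.pair a n)).map (fun m => decide (m = 0)) →
          b ∈ (fun m => decide (m = 0)) <$> f (Nat.pair a n) := by
        intro b n hb
        obtain ⟨m, hm, rfl⟩ := (Part.mem_map_iff _).1 hb
        exact (Part.mem_map_iff _).2 ⟨m, hF1 _ _ _ hm, rfl⟩
      exact ⟨key _ _ h.1, fun hm => key _ _ (h.2 hm)⟩
    · intro a v h
      replace h := Nat.mem_rfind.1 h
      have key : ∀ b n, b ∈ (fun m => decide (m = 0)) <$> f (Nat.pair a n) →
          ∀ᶠ k in atTop, b ∈ (F (history β k) (Nat.pair a n)).map (fun m => decide (m = 0)) := by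
        intro b n hb
        obtain ⟨m, hm, rfl⟩ := (Part.mem_map_iff _).1 hb
        filter_upwards [hF2 _ _ hm] with k hk
        exact (Part.mem_map_iff _).2 ⟨m, hk, rfl⟩
      -- A search that stops at `v` tests only finitely many smaller values, so one history serves
      -- them all.
      have hall : ∀ᶠ k in atTop, ∀ m < v,
          false ∈ (F (history β k) (Nat.pair a m)).map (fun m => decide (m = 0)) :=
        (Set.finite_lt_nat v).eventually_all.2 fun m hm => key _ _ (h.2 hm)
      filter_upwards [key _ _ h.1, hall] with k h1 h2
      exact Nat.mem_rfind.2 ⟨h1, fun hm => h2 _ hm⟩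

/-! ### Triggers and the diagonal argument -/

/-- Whether the program with index `n`, on a history contained in `r` and the input `n`, is seen to
output `1`; the history and the number of steps are read off from the length of `r`. -/
def trigger (n : ℕ) (r : List Bool) : Bool :=
  decide (Code.evaln r.length.unpair.2 (ofNat Code n)
    (encode (r.drop (r.length - r.length.unpair.1), n)) = some 1)

theorem primrec_trigger : Primrec₂ trigger := by
  have hl : Primrec fun p : ℕ × List Bool => p.2.length := Primrec.list_length.comp Primrec.snd
  have hu : Primrec fun p : ℕ × List Bool => p.2.length.unpair := Primrec.unpair.comp hl
  refine Primrec.eq.decide.comp (Code.primrec_evaln.comp (Primrec.pair (Primrec.pair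
    (Primrec.snd.comp hu) ((Primrec.ofNat Code).comp Primrec.fst))
    (Primrec.encode.comp (Primrec.pair ?_ Primrec.fst)))) (Primrec.const _)
  exact Primrec.list_drop.comp (Primrec.nat_sub.comp hl (Primrec.fst.comp hu)) Primrec.snd

/-- Length `Nat.pair j t` tests the history of length `j` for `t` steps, so every such combination
is tried; since `j` is at most `Nat.pair j t`, the needed bits are already present. -/
theorem exists_trigger_iff (β : Cantor) (n : ℕ) :
    (∃ k, trigger n (history β k) = true) ↔
      ∃ j, 1 ∈ (ofNat Code n).eval (encode (history β j, n)) := by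
  have key : ∀ k, (history β k).drop (k - k.unpair.1) = history β k.unpair.1 := by
    intro k
    have := drop_history β (k - k.unpair.1) k.unpair.1
    rwa [Nat.sub_add_cancel (Nat.unpair_left_le k)] at this
  simp only [trigger, length_history, key, decide_eq_true_eq]
  constructor
  · rintro ⟨k, hk⟩
    exact ⟨_, Code.evaln_sound hk⟩
  · rintro ⟨j, hj⟩
    obtain ⟨t, ht⟩ := Code.evaln_complete.1 hj
    refine ⟨Nat.pair j t, ?_⟩
    simpa using ht

/-- No function recursive in `β` decides which programs trigger along `β`. -/
theorem not_recursiveIn_of_trigger {β : Cantor} {h : ℕ → ℕ}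
    (h0 : ∀ n, (∃ k, trigger n (history β k) = true) → h n = 0)
    (h1 : ∀ n, (¬ ∃ k, trigger n (history β k) = true) → h n = 1) :
    ¬ Nat.RecursiveIn {oracle β} fun n => Part.some (h n) := by
  intro hh
  obtain ⟨F, hF, hF1, hF2⟩ := exists_partrec_history_approx hh
  obtain ⟨c, hc⟩ := Code.exists_code.1 hF
  have hcF : ∀ σ m, c.eval (encode (σ, m)) = F σ m := by
    intro σ m
    rw [hc]
    simp [Part.map_id']
  -- Program `n` is the supposed decider itself. It triggers iff it answers `1` at `n`, while a
  -- correct answer `1` means that it does not trigger.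
  obtain ⟨n, rfl⟩ : ∃ n, ofNat Code n = c := ⟨encode c, ofNat_encode c⟩
  by_cases ht : ∃ k, trigger n (history β k) = true
  · obtain ⟨j, hj⟩ := (exists_trigger_iff β n).1 ht
    rw [hcF] at hj
    have := hF1 _ _ _ hj
    rw [Part.mem_some_iff, h0 n ht] at this
    omega
  · obtain ⟨j, hj⟩ := (hF2 n 1 (by simp [h1 n ht])).exists
    exact ht ((exists_trigger_iff β n).2 ⟨j, by rwa [hcF]⟩)

/-! ### The density martingale -/

/-- Four times the conditional probability, given the history `r`, that the first coordinate is
the point with index `2 * n`, given that its index is `2 * n` or `2 * n + 1`. It is `2` until the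
program with index `n` triggers; the bit that follows then decides between `3` and `1`. -/
def dens (n : ℕ) : List Bool → ℕ
  | [] => 2
  | b :: r => if dens n r = 2 ∧ trigger n r = true then (bif b then 3 else 1) else dens n r

theorem primrec_dens : Primrec₂ dens := by
  have : Primrec fun p : ℕ × List Bool => (List.rec 2 (fun b r IH =>
      if IH = 2 ∧ trigger p.1 r = true then (bif b then 3 else 1) else IH) p.2 : ℕ) := by
    refine Primrec.list_rec Primrec.snd (Primrec.const 2) (h := fun (p : ℕ × List Bool) q =>
      if q.2.2 = 2 ∧ trigger p.1 q.2.1 = true then (bif q.1 then 3 else 1) else q.2.2) ?_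
    have hIH : Primrec fun x : (ℕ × List Bool) × Bool × List Bool × ℕ => x.2.2.2 :=
      Primrec.snd.comp (Primrec.snd.comp Primrec.snd)
    refine Primrec.ite (PrimrecPred.and (Primrec.eq.comp hIH (Primrec.const 2))
      (Primrec.eq.comp (primrec_trigger.comp (Primrec.fst.comp Primrec.fst)
        (Primrec.fst.comp (Primrec.snd.comp Primrec.snd))) (Primrec.const true))) ?_ hIH
    exact Primrec.cond (Primrec.fst.comp Primrec.snd) (Primrec.const 3) (Primrec.const 1)
  refine this.of_eq fun ⟨n, r⟩ => ?_
  simp only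
  induction r with
  | nil => rfl
  | cons b r ih => simp only [dens, ← ih]

theorem dens_le (n : ℕ) (r : List Bool) : dens n r ≤ 3 := by
  induction r with
  | nil => simp [dens]
  | cons b r ih =>
    rw [dens]
    cases b <;> split_ifs <;> simp_all

/-- The martingale property for a fair bit; at a trigger it reads `1 + 3 = 2 * 2`. -/
theorem dens_cons_add (n : ℕ) (r : List Bool) :
    dens n (false :: r) + dens n (true :: r) = 2 * dens n r := by
  simp only [dens]
  split_ifs with h
  · simp [h.1]
  · omega

theorem dens_history_eq_two {β : Cantor} {n : ℕ} (h : ¬ ∃ k, trigger n (history β k) = true)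
    (k : ℕ) : dens n (history β k) = 2 := by
  push Not at h
  induction k with
  | zero => rfl
  | succ k ih => rw [history, dens, if_neg (by simp [h k]), ih]

theorem dens_history_of_ne {β : Cantor} {n k : ℕ} (h : dens n (history β k) ≠ 2) (j : ℕ) :
    dens n (history β (k + j)) = dens n (history β k) := by
  induction j with
  | zero => rfl
  | succ j ih => rw [← add_assoc, history, dens, if_neg (by simp [ih, h]), ih]

theorem dens_history_succ_ne {β : Cantor} {n k : ℕ} (h : trigger n (history β k) = true) :
    dens n (history β (k + 1)) ≠ 2 := by
  rw [history, dens]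
  split_ifs with h'
  · cases β k <;> simp
  · exact fun h2 => h' ⟨h2, h⟩

/-- A density that has left `2` is frozen, so it settles along every `β`, not just almost every one.
-/
theorem exists_dens_history_limit (n : ℕ) (β : Cantor) :
    ∃ d, (∀ᶠ k in atTop, dens n (history β k) = d) ∧
      (d = 2 ↔ ¬ ∃ k, trigger n (history β k) = true) := by
  by_cases h : ∃ k, trigger n (history β k) = true
  · obtain ⟨k, hk⟩ := h
    refine ⟨dens n (history β (k + 1)), ?_, ?_⟩
    · filter_upwards [eventually_ge_atTop (k + 1)] with m hm
      obtain ⟨j, rfl⟩ := Nat.exists_eq_add_of_le hm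
      exact dens_history_of_ne (dens_history_succ_ne hk) j
    · simp only [dens_history_succ_ne hk, false_iff, not_not]
      exact ⟨k, hk⟩
  · exact ⟨2, Eventually.of_forall (dens_history_eq_two h), by simp [h]⟩

/-- The eventual value of `dens n` along `β`. -/
noncomputable def limDens (n : ℕ) (β : Cantor) : ℕ :=
  (exists_dens_history_limit n β).choose

theorem eventually_dens_eq (n : ℕ) (β : Cantor) :
    ∀ᶠ k in atTop, dens n (history β k) = limDens n β :=
  (exists_dens_history_limit n β).choose_spec.1

theorem limDens_eq_two_iff (n : ℕ) (β : Cantor) :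
    limDens n β = 2 ↔ ¬ ∃ k, trigger n (history β k) = true :=
  (exists_dens_history_limit n β).choose_spec.2

theorem limDens_le (n : ℕ) (β : Cantor) : limDens n β ≤ 3 := by
  obtain ⟨k, hk⟩ := (eventually_dens_eq n β).exists
  exact hk ▸ dens_le n _

/-! ### Coin tossing and the slices of the joint distribution -/

/-- The distribution of a sequence of independent fair coin tosses. -/
noncomputable def coin : Measure Cantor :=
  Measure.infinitePi fun _ : ℕ => (PMF.uniformOfFintype Bool).toMeasure

instance : IsProbabilityMeasure coin := by
  unfold coin
  infer_instance

theorem measurableSet_cylinder (β : Cantor) (k : ℕ) : MeasurableSet (PiNat.cylinder β k) :=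
  (PiNat.isOpen_cylinder _ β k).measurableSet

theorem coin_cylinder (β : Cantor) (k : ℕ) : coin (PiNat.cylinder β k) = 2⁻¹ ^ k := by
  have h : PiNat.cylinder β k = (Finset.range k : Set ℕ).pi fun i => {β i} := by
    ext γ
    simp [PiNat.mem_cylinder_iff, Set.mem_pi]
  rw [h, coin, Measure.infinitePi_pi _ fun _ _ => MeasurableSet.singleton _]
  simp

/-- The two portions, `d` and `4 - d`, into which `4` is split. -/
def portion (b : Bool) (d : ℕ) : ℕ := bif b then d else 4 - d

/-- The mass of `point n b` when `d` is the density of the `n`-th pair of points. -/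
noncomputable def weight (n : ℕ) (b : Bool) (d : ℕ) : ℝ≥0∞ :=
  ENNReal.ofReal (portion b d / 2 ^ (n + 3))

/-- The sequence whose only `1` is at position `2 * n` (for `b = true`) or `2 * n + 1`. -/
def point (n : ℕ) (b : Bool) : Cantor :=
  fun i => decide (i = bif b then 2 * n else 2 * n + 1)

theorem portion_true_add_false {d : ℕ} (hd : d ≤ 3) : portion true d + portion false d = 4 := by
  simp [portion]
  omega

/-- The bound `dens_le` keeps `4 - d` from truncating, so the complementary portion is a martingale
too. -/
theorem portion_dens_cons_add (n : ℕ) (b : Bool) (r : List Bool) :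
    portion b (dens n (false :: r)) + portion b (dens n (true :: r)) =
      2 * portion b (dens n r) := by
  have h1 := dens_cons_add n r
  have h2 := dens_le n (false :: r)
  have h3 := dens_le n (true :: r)
  cases b <;> simp only [portion, cond_true, cond_false] <;> omega

theorem weight_dens_cons_add (n : ℕ) (b : Bool) (r : List Bool) :
    weight n b (dens n (false :: r)) + weight n b (dens n (true :: r)) =
      2 * weight n b (dens n r) := by
  have h : (portion b (dens n (false :: r)) : ℝ) + portion b (dens n (true :: r)) =
      2 * portion b (dens n r) := mod_cast portion_dens_cons_add n b r
  rw [weight, weight, weight, ← ENNReal.ofReal_add (by positivity) (by positivity), ← add_div, h,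
    mul_div_assoc, ENNReal.ofReal_mul (by norm_num)]
  simp

theorem weight_dens_le (n : ℕ) (b : Bool) (r : List Bool) : weight n b (dens n r) ≤ 1 := by
  have h := portion_true_add_false (dens_le n r)
  have h1 : portion b (dens n r) ≤ 4 := by cases b <;> omega
  have h2 : (portion b (dens n r) : ℝ) ≤ 4 := by exact_mod_cast h1
  rw [weight, ENNReal.ofReal_le_one, div_le_one (by positivity)]
  calc (portion b (dens n r) : ℝ) ≤ 2 ^ 3 := by linarith
    _ ≤ 2 ^ (n + 3) := by gcongr <;> norm_num

theorem measurable_weight_dens (n : ℕ) (b : Bool) (k : ℕ) :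
    Measurable fun β : Cantor => weight n b (dens n (history β k)) := by
  -- Only the first `k` bits matter, so the function factors through a finite space; the padding by
  -- `false` is never read.
  have h : (fun β : Cantor => weight n b (dens n (history β k))) =
      (fun s : Fin k → Bool =>
        weight n b (dens n (history (fun i => if h : i < k then s ⟨i, h⟩ else false) k))) ∘
        fun β i => β i := by
    funext β
    rw [Function.comp_apply]
    congr 2
    exact history_congr fun i hi => by simp [hi]
  rw [h]
  exact (measurable_of_finite _).comp (by fun_prop)

theorem tendsto_weight_dens (n : ℕ) (b : Bool) (β : Cantor) :
    Tendsto (fun k => weight n b (dens n (history β k))) atTop (𝓝 (weight n b (limDens n β))) :=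
  tendsto_nhds_of_eventually_eq ((eventually_dens_eq n β).mono fun k hk => by rw [hk])

theorem history_update_succ (β : Cantor) (k : ℕ) (b : Bool) :
    history (Function.update β k b) (k + 1) = b :: history β k := by
  rw [history, Function.update_self]
  congr 1
  exact history_congr fun i hi => Function.update_of_ne hi.ne _ _

/-- Splitting the cylinder by its next bit and averaging leaves the value unchanged, by the
martingale property. -/
theorem setLIntegral_weight_dens (n : ℕ) (b : Bool) (β : Cantor) (k j : ℕ) :
    ∫⁻ γ in PiNat.cylinder β k, weight n b (dens n (history γ (k + j))) ∂coin =
      weight n b (dens n (history β k)) * 2⁻¹ ^ k := by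
  induction j generalizing β k with
  | zero =>
    rw [setLIntegral_congr_fun (measurableSet_cylinder β k)
      (g := fun _ => weight n b (dens n (history β k))), setLIntegral_const, coin_cylinder]
    intro γ hγ
    simp only [add_zero]
    rw [history_congr (PiNat.mem_cylinder_iff.1 hγ)]
  | succ j ih =>
    have hd : Disjoint (PiNat.cylinder (Function.update β k false) (k + 1))
        (PiNat.cylinder (Function.update β k true) (k + 1)) := by
      rw [Set.disjoint_left]
      intro γ h1 h2
      have h1 := PiNat.mem_cylinder_iff.1 h1 k (by omega)
      have h2 := PiNat.mem_cylinder_iff.1 h2 k (by omega)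
      simp_all
    have hu : PiNat.cylinder β k = PiNat.cylinder (Function.update β k false) (k + 1) ∪
        PiNat.cylinder (Function.update β k true) (k + 1) := by
      rw [← PiNat.iUnion_cylinder_update β k]
      ext γ
      simp
    rw [hu, lintegral_union (measurableSet_cylinder _ _) hd, ← Nat.add_assoc, Nat.add_right_comm,
      ih, ih, history_update_succ, history_update_succ, ← add_mul, weight_dens_cons_add, pow_succ']
    rw [mul_comm 2, mul_assoc, ← mul_assoc 2, ENNReal.mul_inv_cancel (by simp) (by simp), one_mul]

/-- The part of the joint distribution that sits above `point n b`. -/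
noncomputable def slice (n : ℕ) (b : Bool) : Measure Cantor :=
  coin.withDensity fun β => weight n b (limDens n β)

/-- Dominated convergence carries the martingale identity to the limiting density, so an
uncomputable density has computable masses on cylinders. -/
theorem slice_cylinder (n : ℕ) (b : Bool) (β : Cantor) (k : ℕ) :
    slice n b (PiNat.cylinder β k) = weight n b (dens n (history β k)) * 2⁻¹ ^ k := by
  rw [slice, withDensity_apply _ (measurableSet_cylinder β k)]
  refine tendsto_nhds_unique (l := atTop) (f := fun j : ℕ =>
    ∫⁻ γ in PiNat.cylinder β k, weight n b (dens n (history γ (k + j))) ∂coin) ?_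
    (by simp only [setLIntegral_weight_dens]; exact tendsto_const_nhds)
  refine tendsto_lintegral_of_dominated_convergence (fun _ => 1)
    (fun j => measurable_weight_dens n b _)
    (fun j => Eventually.of_forall fun γ => weight_dens_le n b _) (by simp) ?_
  refine Eventually.of_forall fun γ => ?_
  refine (tendsto_weight_dens n b γ).comp ?_
  exact tendsto_atTop_mono (fun j => Nat.le_add_left j k) tendsto_id

instance (n : ℕ) (b : Bool) : SFinite (slice n b) := by
  unfold slice
  infer_instance

/-! ### The joint distribution and its conditional measures -/

/-- The discrete measure with the weights given by the densities `d`. -/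
noncomputable def mixture (d : ℕ → ℕ) : Measure Cantor :=
  Measure.sum fun n => weight n true (d n) • Measure.dirac (point n true) +
    weight n false (d n) • Measure.dirac (point n false)

/-- The joint distribution. -/
noncomputable def joint : Measure (Cantor × Cantor) :=
  Measure.sum fun n => (Measure.dirac (point n true)).prod (slice n true) +
    (Measure.dirac (point n false)).prod (slice n false)

theorem joint_prod_cylinder {S : Set Cantor} (hS : MeasurableSet S) (β : Cantor) (k : ℕ) :
    joint (S ×ˢ PiNat.cylinder β k) =
      mixture (fun n => dens n (history β k)) S * 2⁻¹ ^ k := by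
  rw [joint, mixture, Measure.sum_apply _ (hS.prod (measurableSet_cylinder β k)),
    Measure.sum_apply _ hS, ← ENNReal.tsum_mul_right]
  congr 1
  funext n
  simp only [Measure.add_apply, Measure.prod_prod, slice_cylinder, Measure.smul_apply, smul_eq_mul]
  ring

/-- The share of `S` in the `n`-th pair of points, in quarters. -/
noncomputable def share (d : ℕ) (S : Set Cantor) (n : ℕ) : ℝ :=
  portion true d * S.indicator 1 (point n true) + portion false d * S.indicator 1 (point n false)

theorem share_nonneg (d : ℕ) (S : Set Cantor) (n : ℕ) : 0 ≤ share d S n := by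
  have (γ : Cantor) : (0 : ℝ) ≤ S.indicator 1 γ := Set.indicator_nonneg (by simp) _
  have h1 := this (point n true)
  have h2 := this (point n false)
  unfold share
  positivity

theorem share_le {d : ℕ} (hd : d ≤ 3) (S : Set Cantor) (n : ℕ) : share d S n ≤ 4 := by
  have (γ : Cantor) : S.indicator (1 : Cantor → ℝ) γ ≤ 1 :=
    Set.indicator_le' (fun _ _ => le_rfl) (fun _ _ => zero_le_one) γ
  have h1 := mul_le_mul_of_nonneg_left (this (point n true)) (Nat.cast_nonneg (portion true d))
  have h2 := mul_le_mul_of_nonneg_left (this (point n false)) (Nat.cast_nonneg (portion false d))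
  have h3 : (portion true d : ℝ) + portion false d = 4 := mod_cast portion_true_add_false hd
  unfold share
  linarith

theorem mixture_real {d : ℕ → ℕ} {S : Set Cantor} (hS : MeasurableSet S) :
    (mixture d).real S = ∑' n, share (d n) S n / 2 ^ (n + 3) := by
  have h (n : ℕ) : (weight n true (d n) • Measure.dirac (point n true) +
      weight n false (d n) • Measure.dirac (point n false)) S =
      ENNReal.ofReal (share (d n) S n / 2 ^ (n + 3)) := by
    have key (b : Bool) : weight n b (d n) * S.indicator 1 (point n b) =
        ENNReal.ofReal (portion b (d n) * S.indicator 1 (point n b) / 2 ^ (n + 3)) := by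
      by_cases hp : point n b ∈ S <;> simp [hp, weight]
    have hnn (b : Bool) :
        (0 : ℝ) ≤ portion b (d n) * S.indicator 1 (point n b) / 2 ^ (n + 3) := by
      have : (0 : ℝ) ≤ S.indicator 1 (point n b) := Set.indicator_nonneg (by simp) _
      positivity
    rw [share, add_div, ENNReal.ofReal_add (hnn _) (hnn _), ← key, ← key]
    simp [Measure.dirac_apply' _ hS]
  rw [Measure.real, mixture, Measure.sum_apply _ hS]
  simp only [h]
  rw [ENNReal.tsum_toReal_eq fun _ => ENNReal.ofReal_ne_top]
  congr 1
  funext n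
  exact ENNReal.toReal_ofReal (div_nonneg (share_nonneg _ _ _) (by positivity))

theorem mixture_univ {d : ℕ → ℕ} (hd : ∀ n, d n ≤ 3) : mixture d Set.univ = 1 := by
  rw [mixture, Measure.sum_apply _ MeasurableSet.univ]
  have h (n : ℕ) : (weight n true (d n) • Measure.dirac (point n true) +
      weight n false (d n) • Measure.dirac (point n false)) Set.univ = 2⁻¹ ^ (n + 1) := by
    have h3 : (portion true (d n) : ℝ) + portion false (d n) = 4 :=
      mod_cast portion_true_add_false (hd n)
    simp only [Measure.add_apply, Measure.smul_apply, measure_univ, smul_eq_mul, mul_one]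
    rw [weight, weight, ← ENNReal.ofReal_add (by positivity) (by positivity), ← add_div, h3,
      show (4 : ℝ) / 2 ^ (n + 3) = 2⁻¹ ^ (n + 1) by rw [inv_pow]; field_simp; ring,
      ENNReal.ofReal_pow (by norm_num), ENNReal.ofReal_inv_of_pos (by norm_num)]
    simp
  simp only [h]
  rw [ENNReal.tsum_geometric_add_one, ENNReal.one_sub_inv_two, inv_inv,
    ENNReal.inv_mul_cancel (by simp) (by simp)]

theorem joint_univ_prod_cylinder (β : Cantor) (k : ℕ) :
    joint (Set.univ ×ˢ PiNat.cylinder β k) = 2⁻¹ ^ k := by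
  rw [joint_prod_cylinder MeasurableSet.univ, mixture_univ fun n => dens_le n _, one_mul]

instance : IsProbabilityMeasure joint := by
  refine ⟨?_⟩
  -- The cylinder of length `0` is the whole space.
  have := joint_univ_prod_cylinder (fun _ => false) 0
  simpa using this

theorem summable_bound : Summable fun n : ℕ => (4 : ℝ) / 2 ^ (n + 3) := by
  have : Summable fun n : ℕ => (1 / 2 : ℝ) * (1 / 2) ^ n := summable_geometric_two.mul_left _
  refine this.congr fun n => ?_
  rw [one_div_pow]
  field_simp
  ring

/-- Each term of the series is eventually constant, and the terms have a summable bound independent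
of the stage. -/
theorem tendsto_mixture_real (β : Cantor) {S : Set Cantor} (hS : MeasurableSet S) :
    Tendsto (fun k => (mixture fun n => dens n (history β k)).real S) atTop
      (𝓝 ((mixture fun n => limDens n β).real S)) := by
  simp only [mixture_real hS]
  refine tendsto_tsum_of_dominated_convergence summable_bound (fun n => ?_)
    (Eventually.of_forall fun k n => ?_)
  · exact tendsto_nhds_of_eventually_eq ((eventually_dens_eq n β).mono fun k hk => by rw [hk])
  · rw [Real.norm_of_nonneg (div_nonneg (share_nonneg _ _ _) (by positivity))]
    have := share_le (dens_le n (history β k)) S n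
    gcongr

theorem isConditionalMeasure_mixture (β : Cantor) :
    IsConditionalMeasure joint β (mixture fun n => limDens n β) := by
  refine ⟨fun k => by simp [joint_univ_prod_cylinder], fun S hS => ?_⟩
  refine (tendsto_mixture_real β hS).congr fun k => ?_
  rw [Measure.real, Measure.real, Measure.real, joint_univ_prod_cylinder,
    joint_prod_cylinder hS, ENNReal.toReal_mul, mul_div_assoc, div_self, mul_one]
  simp

/-! ### Computability of the joint distribution -/

theorem history_getD (y : List Bool) :
    history (fun i => y.getD i false) y.length = y.reverse := by
  rw [← List.reverse_inj, List.reverse_reverse]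
  refine List.ext_getElem? fun n => ?_
  rw [reverse_history_getElem?]
  split_ifs with h
  · simp [h]
  · simp at h
    simp [h]

theorem basicOpen_eq_cylinder (y : List Bool) :
    basicOpen y = PiNat.cylinder (fun i => y.getD i false) y.length := by
  ext γ
  rw [PiNat.mem_cylinder_iff]
  refine forall₂_congr fun i h => ?_
  simp [h]

theorem measurableSet_basicOpen (x : List Bool) : MeasurableSet (basicOpen x) := by
  rw [basicOpen_eq_cylinder]
  exact measurableSet_cylinder _ _

theorem mem_basicOpen_iff (x : List Bool) (γ : Cantor) :
    γ ∈ basicOpen x ↔ x = (List.range x.length).map γ := by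
  rw [List.ext_getElem_iff]
  simp [basicOpen, eq_comm]

/-- The share of `basicOpen x` in the `n`-th pair of points, in quarters. -/
def digit (p : List Bool × List Bool) (n : ℕ) : ℕ :=
  portion true (dens n p.2.reverse) *
      (if p.1 = (List.range p.1.length).map (point n true) then 1 else 0) +
    portion false (dens n p.2.reverse) *
      (if p.1 = (List.range p.1.length).map (point n false) then 1 else 0)

theorem share_basicOpen (x y : List Bool) (n : ℕ) :
    share (dens n y.reverse) (basicOpen x) n = digit (x, y) n := by
  classical
  simp only [share, digit, Set.indicator_apply, mem_basicOpen_iff]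
  push_cast
  rfl

theorem digit_le (p : List Bool × List Bool) (n : ℕ) : digit p n ≤ 4 := by
  have := share_le (dens_le n p.2.reverse) (basicOpen p.1) n
  rw [share_basicOpen] at this
  exact_mod_cast this

/-- The natural number with the binary digits `v 0, v 1, …, v (N - 1)`, where a digit may
exceed `1`. -/
def horner (v : ℕ → ℕ) : ℕ → ℕ
  | 0 => 0
  | N + 1 => 2 * horner v N + v N

theorem sum_range_eq_horner (v : ℕ → ℕ) (N : ℕ) :
    ∑ n ∈ Finset.range N, (v n : ℝ) / 2 ^ (n + 3) = horner v N / 2 ^ (N + 2) := by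
  induction N with
  | zero => simp [horner]
  | succ N ih =>
    rw [Finset.sum_range_succ, ih, horner]
    push_cast
    field_simp
    ring

theorem abs_tsum_sub_horner_le {v : ℕ → ℕ} (hv : ∀ n, v n ≤ 4) (N : ℕ) :
    |(∑' n, (v n : ℝ) / 2 ^ (n + 3)) - horner v N / 2 ^ (N + 2)| ≤ 1 / 2 ^ N := by
  have hv' (n : ℕ) : (v n : ℝ) ≤ 4 := mod_cast hv n
  have hs : Summable fun n : ℕ => (v n : ℝ) / 2 ^ (n + 3) :=
    summable_bound.of_nonneg_of_le (fun n => by positivity) fun n => by gcongr; exact hv' n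
  rw [← hs.sum_add_tsum_nat_add N, sum_range_eq_horner, add_sub_cancel_left,
    abs_of_nonneg (tsum_nonneg fun n => by positivity)]
  refine ((summable_nat_add_iff N).2 hs).tsum_le_of_sum_le ?_
  intro s
  -- Digits are at most `4`, so the tail is dominated by a geometric series with sum `1 / 2 ^ N`.
  refine (Finset.sum_le_sum fun n _ => ?_).trans
    (sum_le_hasSum s (fun n _ => by positivity) (hasSum_geometric_two' ((1 : ℝ) / 2 ^ N)))
  calc (v (n + N) : ℝ) / 2 ^ (n + N + 3) ≤ 4 / 2 ^ (n + N + 3) := by gcongr; exact hv' _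
    _ = 1 / 2 ^ N / 2 / 2 ^ n := by field_simp; ring

/-- Adding half the divisor `2 * m` turns floor division into rounding to a nearest integer. -/
theorem abs_round_sub_le (s : ℕ) {m : ℕ} (hm : 0 < m) :
    |(((s + m) / (2 * m) : ℕ) : ℝ) - s / (2 * m)| ≤ 1 / 2 := by
  have h1 := Nat.div_add_mod (s + m) (2 * m)
  have h2 := Nat.mod_lt (s + m) (show 0 < 2 * m by omega)
  generalize (s + m) / (2 * m) = q at *
  generalize (s + m) % (2 * m) = r at *
  have h1 : 2 * (m : ℝ) * q + r = s + m := mod_cast h1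
  have h2 : (r : ℝ) ≤ 2 * m := mod_cast h2.le
  have hm : (0 : ℝ) < m := mod_cast hm
  have : (q : ℝ) - s / (2 * m) = (m - r) / (2 * m) := by
    field_simp
    linarith
  rw [this, abs_div, abs_of_pos (show (0 : ℝ) < 2 * m by linarith), div_le_div_iff₀ (by linarith)
    (by norm_num)]
  have : |(m : ℝ) - r| ≤ m := abs_le.2 ⟨by linarith, by linarith [(Nat.cast_nonneg r : (0:ℝ) ≤ r)]⟩
  linarith

/-- The rational approximation that shows that `joint` is computable. -/
def approx (q : (List Bool × List Bool) × ℕ) : ℕ :=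
  (horner (digit q.1) (q.2 + 1) + 4 * 2 ^ q.1.2.length) / (2 * (4 * 2 ^ q.1.2.length))

theorem joint_real_basicOpen (x y : List Bool) :
    joint.real (basicOpen x ×ˢ basicOpen y) =
      (∑' n, (digit (x, y) n : ℝ) / 2 ^ (n + 3)) / 2 ^ y.length := by
  rw [basicOpen_eq_cylinder y, Measure.real, joint_prod_cylinder (measurableSet_basicOpen x),
    history_getD, ENNReal.toReal_mul, ← Measure.real, mixture_real (measurableSet_basicOpen x)]
  simp [share_basicOpen, div_eq_mul_inv]

/-- Truncating the series after `k + 1` digits and rounding the numerator each cost at most `1 / 2 ^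
(k + 1)`. -/
theorem abs_joint_sub_approx_le (x y : List Bool) (k : ℕ) :
    |joint.real (basicOpen x ×ˢ basicOpen y) - approx ((x, y), k) / 2 ^ k| ≤ 1 / 2 ^ k := by
  have h1 := abs_tsum_sub_horner_le (digit_le (x, y)) (k + 1)
  have h2 := abs_round_sub_le (horner (digit (x, y)) (k + 1))
    (show 0 < 4 * 2 ^ y.length by positivity)
  rw [joint_real_basicOpen, approx]
  simp only
  generalize (∑' n, (digit (x, y) n : ℝ) / 2 ^ (n + 3)) = X at *
  generalize horner (digit (x, y)) (k + 1) = s at *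
  generalize (s + 4 * 2 ^ y.length) / (2 * (4 * 2 ^ y.length)) = a at *
  push_cast at h2
  have e1 : X / 2 ^ y.length - a / 2 ^ k = (X - s / 2 ^ (k + 1 + 2)) / 2 ^ y.length -
      (a - s / (2 * (4 * 2 ^ y.length))) / 2 ^ k := by
    field_simp
    ring
  have e2 : |X - s / 2 ^ (k + 1 + 2)| / 2 ^ y.length ≤ 1 / 2 ^ (k + 1) :=
    (div_le_self (abs_nonneg _) (one_le_pow₀ (by norm_num))).trans h1
  have e3 : |(a : ℝ) - s / (2 * (4 * 2 ^ y.length))| / 2 ^ k ≤ 1 / 2 / 2 ^ k := by gcongr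
  rw [e1]
  refine (abs_sub _ _).trans ?_
  rw [abs_div, abs_div, abs_of_pos (show (0 : ℝ) < 2 ^ y.length by positivity),
    abs_of_pos (show (0 : ℝ) < 2 ^ k by positivity)]
  refine (add_le_add e2 e3).trans (le_of_eq ?_)
  field_simp
  ring

theorem primrec_two_pow : Primrec fun n : ℕ => 2 ^ n := by
  refine (Primrec.nat_rec₁ (f := fun _ s => 2 * s) 1
    (Primrec.nat_mul.comp (Primrec.const 2) Primrec.snd)).of_eq fun n => ?_
  induction n with
  | zero => rfl
  | succ n ih => rw [pow_succ']; exact congrArg _ ih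

theorem primrec_intCast : Primrec fun n : ℕ => (n : ℤ) := by
  refine Primrec.encode_iff.1 ?_
  exact (Primrec.nat_mul.comp (Primrec.const 2) Primrec.id).of_eq fun n => rfl

theorem primrec_map_point (b : Bool) :
    Primrec₂ fun (n l : ℕ) => (List.range l).map (point n b) := by
  refine Primrec.list_map (Primrec.list_range.comp Primrec.snd) ?_
  refine Primrec.eq.decide.comp Primrec.snd ?_
  have h : Primrec fun q : (ℕ × ℕ) × ℕ => 2 * q.1.1 :=
    Primrec.nat_mul.comp (Primrec.const 2) (Primrec.fst.comp Primrec.fst)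
  cases b
  · exact Primrec.succ.comp h
  · exact h

theorem primrec_digit : Primrec₂ digit := by
  have hx : Primrec fun q : (List Bool × List Bool) × ℕ => q.1.1 := Primrec.fst.comp Primrec.fst
  have hd : Primrec fun q : (List Bool × List Bool) × ℕ => dens q.2 q.1.2.reverse :=
    primrec_dens.comp Primrec.snd (Primrec.list_reverse.comp (Primrec.snd.comp Primrec.fst))
  have hm (b : Bool) : Primrec fun q : (List Bool × List Bool) × ℕ =>
      if q.1.1 = (List.range q.1.1.length).map (point q.2 b) then 1 else 0 :=
    Primrec.ite (Primrec.eq.comp hx ((primrec_map_point b).comp Primrec.snd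
      (Primrec.list_length.comp hx))) (Primrec.const 1) (Primrec.const 0)
  exact Primrec.nat_add.comp (Primrec.nat_mul.comp hd (hm true))
    (Primrec.nat_mul.comp (Primrec.nat_sub.comp (Primrec.const 4) hd) (hm false))

theorem primrec_approx : Primrec approx := by
  have hh : Primrec₂ fun (p : List Bool × List Bool) (N : ℕ) => horner (digit p) N := by
    refine (Primrec.nat_rec (f := fun _ => 0)
      (g := fun (p : List Bool × List Bool) (s : ℕ × ℕ) => 2 * s.2 + digit p s.1)
      (Primrec.const 0) ?_).of_eq fun p N => ?_
    · exact Primrec.nat_add.comp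
        (Primrec.nat_mul.comp (Primrec.const 2) (Primrec.snd.comp Primrec.snd))
        (primrec_digit.comp Primrec.fst (Primrec.fst.comp Primrec.snd))
    · induction N with
      | zero => rfl
      | succ N ih => exact congrArg (fun s => 2 * s + digit p N) ih
  have hp : Primrec fun q : (List Bool × List Bool) × ℕ => 4 * 2 ^ q.1.2.length :=
    Primrec.nat_mul.comp (Primrec.const 4) (primrec_two_pow.comp
      (Primrec.list_length.comp (Primrec.snd.comp Primrec.fst)))
  exact Primrec.nat_div.comp
    (Primrec.nat_add.comp (hh.comp Primrec.fst (Primrec.succ.comp Primrec.snd)) hp)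
    (Primrec.nat_mul.comp (Primrec.const 2) hp)

theorem bivariateComputable_joint : BivariateComputable joint :=
  ⟨fun q => (approx q : ℤ), (primrec_intCast.comp primrec_approx).computableIn,
    fun p k => by simpa using abs_joint_sub_approx_le p.1 p.2 k⟩

/-! ### Uncomputability of the conditional measures -/

/-- The prefix ends exactly at the only `1` of `point n true`, at position `2 * n`, which no other
point shares. -/
theorem point_mem_basicOpen_iff (m n : ℕ) (b : Bool) :
    point m b ∈ basicOpen ((List.range (2 * n + 1)).map (point n true)) ↔
      m = n ∧ b = true := by
  constructor
  · intro h
    have := h (2 * n) (by simp)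
    simp only [point, List.getElem_map, List.getElem_range, cond_true, decide_true,
      decide_eq_true_eq] at this
    cases b
    · simp only [cond_false] at this
      omega
    · simp only [cond_true] at this
      exact ⟨by omega, rfl⟩
  · rintro ⟨rfl, rfl⟩ i hi
    simp

theorem mixture_real_basicOpen (d : ℕ → ℕ) (n : ℕ) :
    (mixture d).real (basicOpen ((List.range (2 * n + 1)).map (point n true))) =
      d n / 2 ^ (n + 3) := by
  classical
  rw [mixture_real (measurableSet_basicOpen _), tsum_eq_single n]
  · simp [share, point_mem_basicOpen_iff, portion]
  · intro m hm
    simp [share, point_mem_basicOpen_iff, hm]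

theorem not_measureComputableRel_mixture (β : Cantor) :
    ¬ MeasureComputableRel β (mixture fun n => limDens n β) := by
  rintro ⟨a, ha, hF⟩
  set pre : ℕ → List Bool × ℕ :=
    fun n => ((List.range (2 * n + 1)).map (point n true), n + 5) with hpre
  -- At precision `n + 5` the numerator is within `1` of four times the density. Density `2` gives
  -- `7`, `8` or `9`; any other density gives at most `5` or at least `11`.
  set post : ℕ → ℕ := fun m =>
    if ofNat ℤ m = 7 ∨ ofNat ℤ m = 8 ∨ ofNat ℤ m = 9 then 1 else 0 with hpost
  have hpre' : Primrec pre :=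
    Primrec.pair ((primrec_map_point true).comp Primrec.id (Primrec.succ.comp
      (Primrec.nat_mul.comp (Primrec.const 2) Primrec.id)))
      (Primrec.nat_add.comp Primrec.id (Primrec.const 5))
  have hpost' : Primrec post := by
    have (z : ℤ) : PrimrecPred fun m : ℕ => ofNat ℤ m = z :=
      Primrec.eq.comp (Primrec.ofNat ℤ) (Primrec.const z)
    exact Primrec.ite ((this 7).or ((this 8).or (this 9))) (Primrec.const 1) (Primrec.const 0)
  have hrec : Nat.RecursiveIn {oracle β} fun n => Part.some (post (encode (a (pre n)))) := by
    refine ((Nat.Primrec.recursiveIn (Primrec.nat_iff.1 hpost')).comp (ha.comp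
      (Nat.Primrec.recursiveIn (Primrec.nat_iff.1 (Primrec.encode_iff.2 hpre'))))).of_eq
      fun n => ?_
    simp [-decode_prod_val, encodek]
  have hval (n : ℕ) : |4 * (limDens n β : ℤ) - a (pre n)| ≤ 1 := by
    have h := hF (pre n).1 (pre n).2
    simp only [hpre, mixture_real_basicOpen] at h
    have e : (limDens n β : ℝ) / 2 ^ (n + 3) - a (pre n) / 2 ^ (n + 5) =
        (4 * limDens n β - a (pre n)) / 2 ^ (n + 5) := by
      field_simp
      ring
    rw [hpre] at e
    rw [e, abs_div, abs_of_pos (show (0 : ℝ) < 2 ^ (n + 5) by positivity),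
      div_le_div_iff_of_pos_right (by positivity)] at h
    exact_mod_cast h
  refine not_recursiveIn_of_trigger (fun n hn => ?_) (fun n hn => ?_) hrec
  · have h := abs_le.1 (hval n)
    have h2 : limDens n β ≠ 2 := fun h => (limDens_eq_two_iff n β).1 h hn
    simp only [hpost, ofNat_encode]
    rw [if_neg]
    omega
  · have h := abs_le.1 (hval n)
    have h2 : limDens n β = 2 := (limDens_eq_two_iff n β).2 hn
    simp only [hpost, ofNat_encode]
    rw [if_pos]
    omega

end CantorMeasure

theorem mainTheorem2 :
    ∃ P : MeasureTheory.Measure (CantorMeasure.Cantor × CantorMeasure.Cantor),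
      MeasureTheory.IsProbabilityMeasure P ∧
      CantorMeasure.BivariateComputable P ∧
      MeasureTheory.NullMeasurableSet
        {β : CantorMeasure.Cantor | ∃ ν : MeasureTheory.Measure CantorMeasure.Cantor,
          MeasureTheory.IsProbabilityMeasure ν ∧
          CantorMeasure.IsConditionalMeasure P β ν ∧
          ¬ CantorMeasure.MeasureComputableRel β ν}
        (CantorMeasure.marginal P) ∧
      0 < CantorMeasure.marginal P
        {β : CantorMeasure.Cantor | ∃ ν : MeasureTheory.Measure CantorMeasure.Cantor,
          MeasureTheory.IsProbabilityMeasure ν ∧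
          CantorMeasure.IsConditionalMeasure P β ν ∧
          ¬ CantorMeasure.MeasureComputableRel β ν} := by
  refine ⟨CantorMeasure.joint, inferInstance, CantorMeasure.bivariateComputable_joint, ?_⟩
  have h : {β : CantorMeasure.Cantor | ∃ ν : MeasureTheory.Measure CantorMeasure.Cantor,
      MeasureTheory.IsProbabilityMeasure ν ∧
      CantorMeasure.IsConditionalMeasure CantorMeasure.joint β ν ∧
      ¬ CantorMeasure.MeasureComputableRel β ν} = Set.univ :=
    Set.eq_univ_of_forall fun β => ⟨CantorMeasure.mixture fun n => CantorMeasure.limDens n β,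
      ⟨CantorMeasure.mixture_univ fun n => CantorMeasure.limDens_le n β⟩,
      CantorMeasure.isConditionalMeasure_mixture β,
      CantorMeasure.not_measureComputableRel_mixture β⟩
  rw [h]
  refine ⟨MeasureTheory.nullMeasurableSet_univ, ?_⟩
  rw [CantorMeasure.marginal, MeasureTheory.Measure.map_apply measurable_snd MeasurableSet.univ]
  simp
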